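/- For $q$-uniform hypergraphs $F$ and $H$ (identified with their edge sets), a subgraph $G\subseteq F$ is called weakly $H$-saturated in $F$ if the edges of $F\setminus G$ can be ordered as $e_1,\dots,e_k$ so that for every $i\in\{1,\dots,k\}$ the hypergraph $G\cup\{e_1,\dots,e_i\}$ contains an isomorphic copy of $H$ which in turn contains the edge $e_i$. The weak saturation number $\mathrm{wsat}(F,H)$ is the minimum number of edges in a weakly $H$-saturated subgraph of $F$. The complete $d$-partite $q$-uniform hypergraph $K^q_{n_1,\dots,n_d}$ has as its vertex set a disjoint union of sets $N_1,\dots,N_d$ with $|N_i|=n_i$, and its edges are all $q$-element sets of vertices that meet each $N_i$ in at most one vertex; $K^q(r;d)$ denotes $K^q_{r,\dots,r}$ ($d$ times). For all integers $d\ge q\ge 2$ and $n_1,\dots,n_d\ge r\ge 1$, $$\mathrm{wsat}\bigl(K^q_{n_1,\dots,n_d},K^q(r;d)\bigr)=\sum_{I\in\binom{[d]}{q}}\ \prod_{i\in I}n_i\;-\sum_{I\in\binom{[d]}{\le q}}\ \prod_{i\in I}(n_i-r),$$ where $\binom{[d]}{q}$ and $\binom{[d]}{\le q}$ are the sets of all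 subsets of $[d]=\{1,\dots,d\}$ of size exactly $q$ and at most $q$ respectively, and the empty product equals $1$. -/

import Mathlib

namespace WeakSat

/-- A finite hypergraph on the vertex type `V` is identified with its edge set, a
`Finset (Finset V)`. It is a `q`-graph if all its edges have exactly `q` vertices. -/
def IsUniform {V : Type*} (q : ℕ) (F : Finset (Finset V)) : Prop :=
  ∀ e ∈ F, e.card = q

/-- `G` contains an isomorphic copy of `H` (the image of `H` under an injection `f` of its vertex
set) which in turn contains the edge `e`. -/
def HasCopyThrough {V W : Type*} (H : Finset (Finset W)) (G : Finset (Finset V))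
    (e : Finset V) : Prop :=
  ∃ f : W ↪ V, (∀ h ∈ H, h.map f ∈ G) ∧ ∃ h ∈ H, h.map f = e

/-- `l = [e₁, …, eₖ]` is an `H`-saturating sequence of `G` in `F`: it is an ordering of the edges
of `F \ G`, and for every `i` the hypergraph `G ∪ {e₁, …, eᵢ}` contains a copy of `H` that contains
`eᵢ` (positions of the list are counted from `0`). -/
def IsSaturatingSequence {V W : Type*} [DecidableEq V] (F : Finset (Finset V))
    (H : Finset (Finset W)) (G : Finset (Finset V)) (l : List (Finset V)) : Prop :=
  l.Nodup ∧ l.toFinset = F \ G ∧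
    ∀ (i : ℕ) (hi : i < l.length), HasCopyThrough H (G ∪ (l.take (i + 1)).toFinset) l[i]

/-- The (spanning) subgraph `G` of `F` is weakly `H`-saturated in `F`. -/
def IsWeaklySaturated {V W : Type*} [DecidableEq V] (F : Finset (Finset V))
    (H : Finset (Finset W)) (G : Finset (Finset V)) : Prop :=
  G ⊆ F ∧ ∃ l : List (Finset V), IsSaturatingSequence F H G l

/-- The (undirected) weak saturation number `wsat(F, H)`: the minimum number of edges in a weakly
`H`-saturated subgraph of `F`. -/
noncomputable def wsat {V W : Type*} [DecidableEq V] (F : Finset (Finset V))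
    (H : Finset (Finset W)) : ℕ :=
  sInf {m : ℕ | ∃ G : Finset (Finset V), IsWeaklySaturated F H G ∧ G.card = m}

/-- The minimum defining `wsat` is over a non-empty set and hence attained. -/
theorem wsat_spec {V W : Type*} [DecidableEq V] (F : Finset (Finset V))
    (H : Finset (Finset W)) :
    IsLeast {m : ℕ | ∃ G : Finset (Finset V), IsWeaklySaturated F H G ∧ G.card = m}
      (wsat F H) := by
  refine ⟨Nat.sInf_mem ⟨F.card, F, ⟨subset_rfl, [], ?_⟩, rfl⟩, fun m hm => Nat.sInf_le hm⟩
  exact ⟨List.nodup_nil, by simp, fun i hi => absurd hi (by simp)⟩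

/-- The complete `d`-partite `q`-graph `K^q_{n₁, …, n_d}`: its vertex set is the disjoint union of
the sets `Fin (n i)`, `i : Fin d`, and its edges are all `q`-subsets that meet every partition class
in at most one vertex. -/
def completeMultipartite (q : ℕ) {d : ℕ} (n : Fin d → ℕ) :
    Finset (Finset (Σ i : Fin d, Fin (n i))) :=
  {e ∈ Finset.univ.powersetCard q | ∀ i : Fin d, {v ∈ e | v.1 = i}.card ≤ 1}

theorem completeMultipartite_isUniform (q : ℕ) {d : ℕ} (n : Fin d → ℕ) :
    IsUniform q (completeMultipartite q n) := by
  intro e he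
  exact (Finset.mem_powersetCard.1 (Finset.mem_filter.1 he).1).2

end WeakSat

/-! Lower bound: let a space of functions on the edges contain, for every copy of `H` in `F`, a
function whose support in `F` is exactly that copy. Along a saturating sequence these functions are
triangular, so at most its dimension many edges are missing (`IsWeaklySaturated.card_le`). To build
a small such space, give each vertex of class `i` its weight in the Lagrange formula extrapolating
to `0` from the `r` vertices that the copy uses there. These weights are nonzero exactly on those
vertices and lie in an affine space with `n i - r` directions (`exists_affine_family_support`).
Expanding the products of weights over edges (`exists_span_prod`) leaves one spanning vector per set
`J` of at most `q` classes and choice of a direction in each class of `J`, which is the subtracted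
sum.

Upper bound: delete one edge for each such choice; copies restore them in order of increasing
`J.card` (`exists_isWeaklySaturated`). -/

namespace WeakSat

/-! ### Criteria for the two bounds, for arbitrary hypergraphs -/

/-- If every copy of `H` in `F` supports, with full support, a vector of the span of a family
of `Fintype.card ι` vectors, then a weakly `H`-saturated subgraph of `F` misses at most
`Fintype.card ι` edges. -/
theorem IsWeaklySaturated.card_le {V W ι : Type*} [DecidableEq V] [Fintype ι]
    {F : Finset (Finset V)} {H : Finset (Finset W)} {G : Finset (Finset V)}
    (hG : IsWeaklySaturated F H G) (w : ι → Finset V → ℚ)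
    (hw : ∀ f : W ↪ V, (∀ h ∈ H, h.map f ∈ F) → ∃ u ∈ Submodule.span ℚ (Set.range w),
      (∀ h ∈ H, u (h.map f) ≠ 0) ∧ ∀ e ∈ F, u e ≠ 0 → ∃ h ∈ H, h.map f = e) :
    F.card ≤ G.card + Fintype.card ι := by
  obtain ⟨hGF, l, hnd, hl, hcopy⟩ := hG
  have hlF : ∀ i : Fin l.length, l[i] ∈ F \ G := fun i => by
    rw [← hl, List.mem_toFinset]; exact List.getElem_mem _
  have key : ∀ i : Fin l.length, ∃ u ∈ Submodule.span ℚ (Set.range w),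
      u l[i] ≠ 0 ∧ ∀ j : Fin l.length, i < j → u l[j] = 0 := by
    intro i
    obtain ⟨f, hf, h, hh, hfe⟩ := hcopy i i.2
    have hsub : G ∪ (l.take (i + 1)).toFinset ⊆ F := by
      refine Finset.union_subset hGF fun e he => ?_
      have he' : e ∈ l.toFinset :=
        List.mem_toFinset.2 (List.mem_of_mem_take (List.mem_toFinset.1 he))
      rw [hl] at he'
      exact (Finset.mem_sdiff.1 he').1
    obtain ⟨u, hu, hne, hsupp⟩ := hw f fun h hh => hsub (hf h hh)
    refine ⟨u, hu, ?_, fun j hij => ?_⟩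
    · have := hne h hh
      rw [hfe] at this
      exact this
    -- A later edge is neither in `G` nor yet added, so the copy at step `i` misses it.
    · by_contra hj
      obtain ⟨h', hh', hfj⟩ := hsupp _ (Finset.mem_sdiff.1 (hlF j)).1 hj
      have hmem := hf h' hh'
      rw [hfj, Finset.mem_union, List.mem_toFinset] at hmem
      rcases hmem with hmem | hmem
      · exact (Finset.mem_sdiff.1 (hlF j)).2 hmem
      · obtain ⟨k, hk, hkj⟩ := List.mem_take_iff_getElem.1 hmem
        have := (hnd.getElem_inj_iff).1 hkj
        have hij' : (i : ℕ) < j := hij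
        omega
  choose u hu hne hzero using key
  let M : Matrix (Fin l.length) (Fin l.length) ℚ := fun i j => u i l[j]
  have hdet : M.det ≠ 0 := by
    rw [Matrix.det_of_isLowerTriangular M fun i j hij => hzero i j hij]
    exact Finset.prod_ne_zero_iff.2 fun i _ => hne i
  have hMli : LinearIndependent ℚ M.row := Matrix.linearIndependent_rows_of_det_ne_zero hdet
  -- Independence after restriction to the added edges suffices.
  have hli : LinearIndependent ℚ u := by
    refine LinearIndependent.of_comp
      (LinearMap.pi fun j : Fin l.length => LinearMap.proj (R := ℚ) (φ := fun _ => ℚ) l[j]) ?_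
    exact hMli
  have hspan : Submodule.span ℚ (Set.range u) ≤ Submodule.span ℚ (Set.range w) :=
    Submodule.span_le.2 (by rintro _ ⟨i, rfl⟩; exact hu i)
  have h1 := finrank_span_eq_card hli
  have : FiniteDimensional ℚ (Submodule.span ℚ (Set.range w)) :=
    FiniteDimensional.span_of_finite ℚ (Set.finite_range w)
  have h2 := Submodule.finrank_mono hspan
  have h3 : Module.finrank ℚ (Submodule.span ℚ (Set.range w)) ≤ Fintype.card ι :=
    finrank_range_le_card w
  rw [h1, Fintype.card_fin] at h2
  have h4 : l.length = (F \ G).card := by rw [← hl, List.toFinset_card_of_nodup hnd]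
  have h5 := Finset.card_sdiff_add_card_eq_card hGF
  omega

/-- Deleting from `F` a family of edges, ranked by `ρ`, such that each of them lies in a copy of
`H` all of whose other deleted edges have smaller rank, leaves a weakly `H`-saturated graph. -/
theorem isWeaklySaturated_sdiff_image {V W ι : Type*} [DecidableEq V] [Fintype ι]
    {F : Finset (Finset V)} {H : Finset (Finset W)} (e : ι → Finset V)
    (he : Function.Injective e) (heF : ∀ i, e i ∈ F) (ρ : ι → ℕ)
    (hcopy : ∀ i, ∃ f : W ↪ V, (∀ h ∈ H, h.map f ∈ F) ∧ (∃ h ∈ H, h.map f = e i) ∧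
      ∀ h ∈ H, ∀ j, h.map f = e j → j = i ∨ ρ j < ρ i) :
    IsWeaklySaturated F H (F \ Finset.univ.image e) := by
  classical
  refine ⟨Finset.sdiff_subset, ?_⟩
  let s : List ι := (Finset.univ : Finset ι).toList.insertionSort (fun i j => ρ i ≤ ρ j)
  have : Std.Total (fun i j : ι => ρ i ≤ ρ j) := ⟨fun i j => le_total _ _⟩
  have : IsTrans ι (fun i j : ι => ρ i ≤ ρ j) := ⟨fun i j k => le_trans⟩
  have hsort : s.Pairwise (fun i j => ρ i ≤ ρ j) := List.pairwise_insertionSort _ _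
  have hperm : s.Perm (Finset.univ : Finset ι).toList := List.perm_insertionSort _ _
  have hmem : ∀ i, i ∈ s := fun i => hperm.mem_iff.2 (by simp)
  have hnd : s.Nodup := hperm.nodup_iff.2 (Finset.nodup_toList _)
  refine ⟨s.map e, hnd.map he, ?_, fun k hk => ?_⟩
  · rw [Finset.sdiff_sdiff_eq_self]
    · ext x
      simp [hmem]
    · intro x hx
      obtain ⟨i, -, rfl⟩ := Finset.mem_image.1 hx
      exact heF i
  · rw [List.length_map] at hk
    obtain ⟨f, hfF, hfe, hlt⟩ := hcopy s[k]
    refine ⟨f, fun h hh => ?_, by simpa using hfe⟩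
    rw [Finset.mem_union, Finset.mem_sdiff]
    by_cases hB : h.map f ∈ Finset.univ.image e
    · right
      obtain ⟨j, -, hj⟩ := Finset.mem_image.1 hB
      rw [List.mem_toFinset, ← List.map_take, List.mem_map]
      refine ⟨j, ?_, hj⟩
      obtain ⟨m, hm, rfl⟩ := List.getElem_of_mem (hmem j)
      rw [List.mem_take_iff_getElem]
      refine ⟨m, ?_, rfl⟩
      rw [lt_min_iff]
      refine ⟨?_, hm⟩
      -- Any other deleted edge of the copy has strictly smaller rank, so it cannot come later in
      -- the sorted list.
      by_contra hkm
      have hkm' : k < m := by omega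
      have hle := List.pairwise_iff_getElem.1 hsort k m hk hm hkm'
      rcases hlt h hh _ hj.symm with heq | hlt'
      · have := (hnd.getElem_inj_iff).1 heq
        omega
      · omega
    · exact Or.inl ⟨hfF h hh, hB⟩

/-! ### Lagrange extrapolation weights -/

/-- The vectors on `Fin n` that extend evaluation at `0` (at the nodes `1, …, n`) of the
polynomials of degree less than `r`: one for each `r`-subset, with that set as its support, and all
of them in a common affine space of dimension `n - r`. -/
theorem exists_affine_family_support (n r : ℕ) (hrn : r ≤ n) :
    ∃ (b : Fin n → ℚ) (v : Fin (n - r) → Fin n → ℚ), ∀ R : Finset (Fin n), R.card = r →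
      ∃ a : Fin n → ℚ, (∀ j, a j ≠ 0 ↔ j ∈ R) ∧
        ∃ c : Fin (n - r) → ℚ, ∀ j, a j = b j + ∑ x, c x * v x j := by
  classical
  -- The shift keeps `0` from being a node, so no weight on `R` vanishes.
  let x : Fin n → ℚ := fun j => (j : ℚ) + 1
  have hx : Function.Injective x := fun i j h => by
    have : (i : ℚ) = j := by simpa [x] using h
    exact Fin.ext (by exact_mod_cast this)
  have hx0 : ∀ j, x j ≠ 0 := fun j => by positivity
  have hw : ∀ R : Finset (Fin n), R.card = r → ∃ a : Fin n → ℚ, (∀ j, a j ≠ 0 ↔ j ∈ R) ∧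
      ∀ p : Polynomial ℚ, p.degree < r → ∑ j, a j * p.eval (x j) = p.eval 0 := by
    intro R hR
    refine ⟨fun j => if j ∈ R then (Lagrange.basis R x j).eval 0 else 0, fun j => ?_,
      fun p hp => ?_⟩
    · by_cases hj : j ∈ R
      · simp only [hj, if_true, iff_true]
        rw [Lagrange.basis, Polynomial.eval_prod, Finset.prod_ne_zero_iff]
        intro i hi
        have hij : x j - x i ≠ 0 := sub_ne_zero.2 fun h => (Finset.mem_erase.1 hi).1 (hx h).symm
        simp [Lagrange.basisDivisor, hij, hx0]
      · simp [hj]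
    · conv_rhs => rw [Lagrange.eq_interpolate (f := p) (s := R) hx.injOn (by rwa [hR])]
      rw [Lagrange.interpolate_apply, Polynomial.eval_finsetSum]
      simp [Finset.sum_ite_mem, mul_comm]
  -- The direction space: two weight vectors agree on all polynomials of degree less than `r`.
  let K : Submodule ℚ (Fin n → ℚ) :=
    { carrier := {c | ∀ p : Polynomial ℚ, p.degree < r → ∑ j, c j * p.eval (x j) = 0}
      add_mem' := fun {a b} ha hb p hp => by
        simp [add_mul, Finset.sum_add_distrib, ha p hp, hb p hp]
      zero_mem' := fun p _ => by simp
      smul_mem' := fun t a ha p hp => by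
        simp [mul_assoc, ← Finset.mul_sum, ha p hp] }
  let R₀ : Finset (Fin n) := Finset.univ.map (Fin.castLEEmb hrn)
  have hR₀ : R₀.card = r := by simp [R₀]
  have hK : Module.finrank ℚ K ≤ n - r := by
    let φ : K →ₗ[ℚ] ({j // j ∉ R₀} → ℚ) :=
      (LinearMap.pi fun j : {j // j ∉ R₀} =>
        LinearMap.proj (R := ℚ) (φ := fun _ : Fin n => ℚ) j.1) ∘ₗ K.subtype
    have hφ : Function.Injective φ := by
      rw [← LinearMap.ker_eq_bot, LinearMap.ker_eq_bot']
      rintro ⟨c, hc⟩ h0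
      have hout : ∀ j, j ∉ R₀ → c j = 0 := fun j hj => congrFun h0 ⟨j, hj⟩
      ext j
      by_cases hj : j ∈ R₀
      -- Testing `c` against this basis polynomial isolates `c j`, as `c` vanishes off `R₀`.
      · have hdeg : (Lagrange.basis R₀ x j).degree < r := by
          rw [Lagrange.degree_basis hx.injOn hj, hR₀]
          have : 0 < r := hR₀ ▸ Finset.card_pos.2 ⟨j, hj⟩
          exact_mod_cast Nat.sub_lt this one_pos
        have := hc _ hdeg
        rw [Finset.sum_eq_single j] at this
        · simpa [Lagrange.eval_basis_self hx.injOn hj] using this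
        · intro i _ hij
          by_cases hi : i ∈ R₀
          · rw [Lagrange.eval_basis_of_ne hij.symm hi, mul_zero]
          · rw [hout i hi, zero_mul]
        · simp
      · exact hout j hj
    have := LinearMap.finrank_le_finrank_of_injective hφ
    rwa [Module.finrank_fintype_fun_eq_card, Fintype.card_subtype_compl, Fintype.card_fin,
      Fintype.card_coe, hR₀] at this
  obtain ⟨b, -, hb⟩ := hw R₀ hR₀
  let B := Module.finBasis ℚ K
  let ι : Fin (Module.finrank ℚ K) ↪ Fin (n - r) := Fin.castLEEmb hK
  -- Only the upper bound on `finrank K` is known, so the basis is padded with zeros.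
  refine ⟨b, fun y => Function.extend ι (fun k => (B k : Fin n → ℚ)) 0 y, fun R hR => ?_⟩
  obtain ⟨a, ha, hap⟩ := hw R hR
  refine ⟨a, ha, ?_⟩
  have hmem : a - b ∈ K := fun p hp => by
    simp [sub_mul, Finset.sum_sub_distrib, hap p hp, hb p hp]
  refine ⟨Function.extend ι (B.repr ⟨a - b, hmem⟩) 0, fun j => ?_⟩
  have hsum := congrFun (congrArg Subtype.val (B.sum_repr ⟨a - b, hmem⟩)) j
  simp only [AddSubmonoidClass.coe_finsetSum, Finset.sum_apply, Submodule.coe_smul,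
    Pi.smul_apply, Pi.sub_apply, smul_eq_mul] at hsum
  rw [← sub_eq_iff_eq_add', ← hsum]
  refine Finset.sum_of_injOn ι ι.injective.injOn (fun _ _ => Finset.mem_coe.2 (Finset.mem_univ _))
    (fun y _ hy => ?_) fun k _ => ?_
  · have : ¬ ∃ k, ι k = y := fun ⟨k, hk⟩ => hy ⟨k, by simp, hk⟩
    rw [Function.extend_apply' _ _ _ this, Pi.zero_apply, zero_mul]
  · beta_reduce
    rw [ι.injective.extend_apply, ι.injective.extend_apply]

/-! ### Edges as transversals -/

section Multipartite

variable {d : ℕ} {n : Fin d → ℕ} {q : ℕ}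

theorem mem_completeMultipartite {e : Finset (Σ i : Fin d, Fin (n i))} :
    e ∈ completeMultipartite q n ↔ e.card = q ∧ Set.InjOn Sigma.fst (e : Set (Σ i, Fin (n i))) := by
  simp only [completeMultipartite, Finset.mem_filter, Finset.mem_powersetCard, Finset.subset_univ,
    true_and, Finset.card_le_one, Finset.mem_filter]
  refine and_congr_right fun _ => ⟨fun h v hv w hw hvw => h w.1 v ⟨hv, hvw⟩ w ⟨hw, rfl⟩, ?_⟩
  rintro h i v ⟨hv, hvi⟩ w ⟨hw, hwi⟩
  exact h hv hw (hvi.trans hwi.symm)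

/-- The vertex set picking the vertex `y i` from each class `i ∈ I`. -/
def transversal (I : Finset (Fin d)) (y : ∀ i : I, Fin (n i)) : Finset (Σ i : Fin d, Fin (n i)) :=
  Finset.univ.map ⟨fun i : I => ⟨i, y i⟩, fun _ _ h => Subtype.ext (congrArg Sigma.fst h)⟩

theorem mem_transversal {I : Finset (Fin d)} {y : ∀ i : I, Fin (n i)} {v : Σ i, Fin (n i)} :
    v ∈ transversal I y ↔ ∃ i : I, ⟨i, y i⟩ = v := by
  simp only [transversal, Finset.mem_map, Finset.mem_univ, true_and]
  rfl

theorem mk_mem_transversal {I : Finset (Fin d)} {y : ∀ i : I, Fin (n i)} {i : Fin d}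
    {k : Fin (n i)} : (⟨i, k⟩ : Σ i, Fin (n i)) ∈ transversal I y ↔ ∃ hi : i ∈ I, y ⟨i, hi⟩ = k := by
  rw [mem_transversal]
  constructor
  · rintro ⟨j, hj⟩
    cases hj
    exact ⟨j.2, rfl⟩
  · rintro ⟨hi, rfl⟩
    exact ⟨⟨i, hi⟩, rfl⟩

theorem transversal_injective :
    Function.Injective fun p : Σ I : Finset (Fin d), ∀ i : I, Fin (n i) => transversal p.1 p.2 := by
  rintro ⟨I, y⟩ ⟨I', y'⟩ h
  have h' : transversal I y = transversal I' y' := h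
  have key : ∀ {i} (hi : i ∈ I), ∃ hi' : i ∈ I', y' ⟨i, hi'⟩ = y ⟨i, hi⟩ := fun {i} hi => by
    rw [← mk_mem_transversal, ← h', mk_mem_transversal]
    exact ⟨hi, rfl⟩
  obtain rfl : I = I' := by
    ext i
    refine ⟨fun hi => (key hi).1, fun hi => ?_⟩
    have : (⟨i, y' ⟨i, hi⟩⟩ : Σ i, Fin (n i)) ∈ transversal I y := by
      rw [h', mk_mem_transversal]
      exact ⟨hi, rfl⟩
    exact (mk_mem_transversal.1 this).1
  congr 1
  funext i
  obtain ⟨_, h⟩ := key i.2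
  exact h.symm

theorem transversal_mem {I : Finset (Fin d)} (hI : I.card = q) (y : ∀ i : I, Fin (n i)) :
    transversal I y ∈ completeMultipartite q n := by
  rw [mem_completeMultipartite]
  refine ⟨by simp [transversal, hI], ?_⟩
  rintro v hv w hw hvw
  obtain ⟨i, rfl⟩ := mem_transversal.1 (Finset.mem_coe.1 hv)
  obtain ⟨j, rfl⟩ := mem_transversal.1 (Finset.mem_coe.1 hw)
  obtain rfl : i = j := Subtype.ext hvw
  rfl

theorem exists_transversal_eq {e : Finset (Σ i : Fin d, Fin (n i))}
    (he : e ∈ completeMultipartite q n) :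
    ∃ (I : Finset (Fin d)) (y : ∀ i : I, Fin (n i)), I.card = q ∧ transversal I y = e := by
  classical
  rw [mem_completeMultipartite] at he
  have hex : ∀ i : (e.image Sigma.fst : Finset (Fin d)), ∃ k : Fin (n i), ⟨i, k⟩ ∈ e := by
    rintro ⟨i, hi⟩
    obtain ⟨⟨j, k⟩, hv, rfl⟩ := Finset.mem_image.1 hi
    exact ⟨k, hv⟩
  choose y hy using hex
  refine ⟨e.image Sigma.fst, y, by rw [Finset.card_image_of_injOn he.2, he.1], ?_⟩
  ext v
  rw [mem_transversal]
  constructor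
  · rintro ⟨i, rfl⟩
    exact hy i
  · intro hv
    exact ⟨⟨v.1, Finset.mem_image_of_mem _ hv⟩, he.2 (hy _) hv rfl⟩

theorem card_completeMultipartite :
    (completeMultipartite q n).card =
      ∑ I ∈ (Finset.univ : Finset (Fin d)).powersetCard q, ∏ i ∈ I, n i := by
  classical
  have : completeMultipartite q n =
      (((Finset.univ : Finset (Fin d)).powersetCard q).sigma
        fun I => (Finset.univ : Finset (∀ i : I, Fin (n i)))).map ⟨_, transversal_injective⟩ := by
    ext e
    simp only [Finset.mem_map, Finset.mem_sigma, Finset.mem_powersetCard, Finset.subset_univ,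
      Finset.mem_univ, true_and, and_true, Function.Embedding.coeFn_mk]
    constructor
    · intro he
      obtain ⟨I, y, hI, rfl⟩ := exists_transversal_eq he
      exact ⟨⟨I, y⟩, hI, rfl⟩
    · rintro ⟨⟨I, y⟩, hI, rfl⟩
      exact transversal_mem hI y
  rw [this, Finset.card_map, Finset.card_sigma]
  refine Finset.sum_congr rfl fun I _ => ?_
  simp only [Finset.card_univ, Fintype.card_pi, Fintype.card_fin]
  exact Finset.prod_coe_sort I n

/-- Partial transversals of at most `q` classes of sizes `m i`. -/
abbrev PartialTransversal (q : ℕ) (m : Fin d → ℕ) : Type :=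
  Σ J : {J : Finset (Fin d) // J.card ≤ q}, ∀ i : J.1, Fin (m i)

theorem card_partialTransversal (m : Fin d → ℕ) :
    Fintype.card (PartialTransversal q m) =
      ∑ J : Finset (Fin d) with J.card ≤ q, ∏ i ∈ J, m i := by
  classical
  rw [Fintype.card_sigma, Finset.sum_subtype (p := fun J : Finset (Fin d) => J.card ≤ q) _ (by simp)]
  refine Finset.sum_congr rfl fun J _ => ?_
  simp only [Fintype.card_pi, Fintype.card_fin]
  exact Finset.prod_coe_sort J.1 m

/-! ### Rigidity of copies -/

/-- A copy of a complete `d`-partite graph in a complete `d`-partite graph respects the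
partition into classes. -/
theorem exists_perm_of_copy (hq : 2 ≤ q) (hqd : q ≤ d) {m : Fin d → ℕ} (hm : ∀ i, 0 < m i)
    (f : (Σ i : Fin d, Fin (m i)) ↪ Σ i : Fin d, Fin (n i))
    (hf : ∀ h ∈ completeMultipartite q m, h.map f ∈ completeMultipartite q n) :
    ∃ σ : Equiv.Perm (Fin d), ∀ w, (f w).1 = σ w.1 := by
  classical
  have hne : ∀ w w', w.1 ≠ w'.1 → (f w).1 ≠ (f w').1 := by
    intro w w' hww
    -- As `2 ≤ q ≤ d`, vertices of different classes share an edge, whose image is again an edge.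
    obtain ⟨I, hwI, -, hI⟩ := Finset.exists_subsuperset_card_eq (n := q)
      (Finset.subset_univ ({w.1, w'.1} : Finset (Fin d)))
      (by rw [Finset.card_pair hww]; exact hq) (by simpa using hqd)
    let y : ∀ i : Fin d, Fin (m i) := fun i =>
      if h : w.1 = i then h ▸ w.2 else if h : w'.1 = i then h ▸ w'.2 else ⟨0, hm i⟩
    have hmem := hf _ (transversal_mem hI fun i => y i)
    rw [mem_completeMultipartite] at hmem
    have hw : w ∈ transversal I fun i => y i := by
      obtain ⟨i, k⟩ := w
      exact mk_mem_transversal.2 ⟨hwI (by simp), by simp [y]⟩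
    have hw' : w' ∈ transversal I fun i => y i := by
      obtain ⟨i, k⟩ := w'
      exact mk_mem_transversal.2 ⟨hwI (by simp), by simp [y, hww]⟩
    intro heq
    have := hmem.2 (Finset.mem_coe.2 (Finset.mem_map_of_mem f hw))
      (Finset.mem_coe.2 (Finset.mem_map_of_mem f hw')) heq
    exact hww (congrArg Sigma.fst (f.injective this))
  let g : Fin d → Fin d := fun i => (f ⟨i, ⟨0, hm i⟩⟩).1
  have hg : Function.Injective g := fun i j hij => by
    by_contra h
    exact hne ⟨i, ⟨0, hm i⟩⟩ ⟨j, ⟨0, hm j⟩⟩ h hij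
  let σ : Equiv.Perm (Fin d) := Equiv.ofBijective g (Finite.injective_iff_bijective.1 hg)
  refine ⟨σ, fun w => ?_⟩
  obtain ⟨j, hj⟩ := σ.surjective (f w).1
  by_cases h : w.1 = j
  · rw [h, hj]
  · exact absurd hj.symm (hne w ⟨j, ⟨0, hm j⟩⟩ h)

/-- The range of a copy of a complete multipartite graph with all classes of size `r` meets every
class in `r` vertices, and the edges it contains are the edges of the copy. -/
theorem copy_range (hq : 2 ≤ q) (hqd : q ≤ d) {r : ℕ} (hr : 0 < r)
    (f : (Σ _ : Fin d, Fin r) ↪ Σ i : Fin d, Fin (n i))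
    (hf : ∀ h ∈ completeMultipartite q (fun _ : Fin d => r), h.map f ∈ completeMultipartite q n) :
    ∃ R : ∀ i, Finset (Fin (n i)), (∀ i, (R i).card = r) ∧ (∀ w, (f w).2 ∈ R (f w).1) ∧
      ∀ e ∈ completeMultipartite q n, (∀ v ∈ e, v.2 ∈ R v.1) →
        ∃ h ∈ completeMultipartite q (fun _ : Fin d => r), h.map f = e := by
  classical
  obtain ⟨σ, hσ⟩ := exists_perm_of_copy hq hqd (fun _ => hr) f hf
  let R : ∀ i, Finset (Fin (n i)) := fun i =>
    Finset.univ.filter fun k => (⟨i, k⟩ : Σ i, Fin (n i)) ∈ Set.range f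
  refine ⟨R, fun i => ?_, fun w => by simp [R], fun e he heR => ?_⟩
  · have h1 : (R i).map (Function.Embedding.sigmaMk (β := fun i => Fin (n i)) i) =
        (Finset.univ : Finset (Fin r)).map
          ⟨fun k => f ⟨σ.symm i, k⟩, fun a b h => eq_of_heq (Sigma.mk.inj (f.injective h)).2⟩ := by
      ext v
      simp only [R, Finset.mem_map, Finset.mem_filter, Finset.mem_univ, true_and,
        Function.Embedding.sigmaMk_apply, Set.mem_range]
      constructor
      · rintro ⟨k, ⟨⟨j, l⟩, hw⟩, rfl⟩
        have := hσ ⟨j, l⟩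
        rw [hw] at this
        obtain rfl : j = σ.symm i := (Equiv.eq_symm_apply σ).2 this.symm
        exact ⟨l, hw⟩
      · rintro ⟨l, rfl⟩
        have := hσ ⟨σ.symm i, l⟩
        rw [Equiv.apply_symm_apply] at this
        generalize hv : f ⟨σ.symm i, l⟩ = v at this
        obtain ⟨j, k⟩ := v
        obtain rfl : j = i := this
        exact ⟨k, ⟨_, hv⟩, rfl⟩
    have h2 := congrArg Finset.card h1
    simpa using h2
  · have hrange : ∀ v ∈ e, v ∈ Set.range f := fun v hv => (Finset.mem_filter.1 (heR v hv)).2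
    obtain ⟨h, rfl⟩ : ∃ h : Finset (Σ _ : Fin d, Fin r), h.map f = e := by
      refine ⟨e.preimage f f.injective.injOn, ?_⟩
      rw [Finset.map_eq_image, Finset.image_preimage]
      exact Finset.filter_true_of_mem hrange
    refine ⟨h, ?_, rfl⟩
    rw [mem_completeMultipartite] at he ⊢
    refine ⟨by rw [← he.1, Finset.card_map], fun w hw w' hw' hww => f.injective ?_⟩
    refine he.2 (Finset.mem_coe.2 (Finset.mem_map_of_mem f hw))
      (Finset.mem_coe.2 (Finset.mem_map_of_mem f hw')) ?_
    rw [hσ, hσ, hww]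

/-! ### Product vectors and the lower bound -/

theorem prod_transversal {M : Type*} [CommMonoid M] (I : Finset (Fin d)) (y : ∀ i, Fin (n i))
    (g : ∀ i, Fin (n i) → M) :
    ∏ v ∈ transversal I (fun i => y i), g v.1 v.2 = ∏ i ∈ I, g i (y i) := by
  rw [transversal, Finset.prod_map]
  exact Finset.prod_coe_sort I fun i => g i (y i)

theorem image_fst_transversal (I : Finset (Fin d)) (y : ∀ i : I, Fin (n i)) :
    (transversal I y).image Sigma.fst = I := by
  ext i
  simp only [Finset.mem_image, mem_transversal]
  constructor
  · rintro ⟨_, ⟨j, rfl⟩, rfl⟩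
    exact j.2
  · exact fun hi => ⟨_, ⟨⟨i, hi⟩, rfl⟩, rfl⟩

/-- Products over the edges of functions from affine families with `m i` directions on the classes
lie in a space spanned by vectors indexed by the partial transversals. -/
theorem exists_span_prod (hn : ∀ i, 0 < n i) (m : Fin d → ℕ) (b : ∀ i, Fin (n i) → ℚ)
    (v : ∀ i, Fin (m i) → Fin (n i) → ℚ) :
    ∃ w : PartialTransversal q m → Finset (Σ i, Fin (n i)) → ℚ, ∀ (a : ∀ i, Fin (n i) → ℚ)
      (c : ∀ i, Fin (m i) → ℚ), (∀ i j, a i j = b i j + ∑ x, c i x * v i x j) →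
        (fun e => if e ∈ completeMultipartite q n then ∏ x ∈ e, a x.1 x.2 else 0) ∈
          Submodule.span ℚ (Set.range w) := by
  classical
  -- Directions on the classes of `J`, base points elsewhere. Edges missing a class of `J` get `0`,
  -- so only `J ⊆ I` contribute.
  refine ⟨fun p e => if e ∈ completeMultipartite q n ∧ p.1.1 ⊆ e.image Sigma.fst then
    ∏ x ∈ e, (if h : x.1 ∈ p.1.1 then v x.1 (p.2 ⟨x.1, h⟩) x.2 else b x.1 x.2) else 0,
    fun a c hac => ?_⟩
  rw [Submodule.mem_span_range_iff_exists_fun]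
  refine ⟨fun p => ∏ i : p.1.1, c i (p.2 i), ?_⟩
  ext e
  simp only [Finset.sum_apply, Pi.smul_apply, smul_eq_mul]
  by_cases he : e ∈ completeMultipartite q n
  swap
  · simp [he]
  simp only [he, true_and, if_true]
  obtain ⟨I, y, hI, rfl⟩ := exists_transversal_eq he
  obtain ⟨Y, rfl⟩ : ∃ Y : ∀ i, Fin (n i), y = fun i : I => Y i :=
    ⟨fun i => if h : i ∈ I then y ⟨i, h⟩ else ⟨0, hn i⟩, by funext i; simp⟩
  simp only [image_fst_transversal]
  let g : Finset (Fin d) → ℚ := fun J => if J ⊆ I then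
    (∏ i ∈ J, ∑ x, c i x * v i x (Y i)) * ∏ i ∈ I \ J, b i (Y i) else 0
  have hterm : ∀ J : {J : Finset (Fin d) // J.card ≤ q},
      ∑ x : (∀ i : J.1, Fin (m i)), (∏ i : J.1, c i (x i)) * (if J.1 ⊆ I then
        ∏ z ∈ transversal I (fun i => Y i),
          (if h : z.1 ∈ J.1 then v z.1 (x ⟨z.1, h⟩) z.2 else b z.1 z.2) else 0) = g J.1 := by
    rintro ⟨J, hJ⟩
    by_cases hJI : J ⊆ I
    swap
    · simp [g, hJI]
    simp only [g, hJI, if_true]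
    rw [← Finset.prod_coe_sort J, Finset.prod_univ_sum, Fintype.piFinset_univ, Finset.sum_mul]
    refine Finset.sum_congr rfl fun x _ => ?_
    rw [prod_transversal I Y fun i k => if h : i ∈ J then v i (x ⟨i, h⟩) k else b i k,
      ← Finset.prod_sdiff hJI, Finset.prod_mul_distrib]
    have h1 : ∏ i ∈ I \ J, (if h : i ∈ J then v i (x ⟨i, h⟩) (Y i) else b i (Y i)) =
        ∏ i ∈ I \ J, b i (Y i) :=
      Finset.prod_congr rfl fun i hi => dif_neg (Finset.mem_sdiff.1 hi).2
    have h2 : ∏ i ∈ J, (if h : i ∈ J then v i (x ⟨i, h⟩) (Y i) else b i (Y i)) =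
        ∏ i : J, v i (x i) (Y i) := by
      rw [← Finset.prod_coe_sort J]
      exact Finset.prod_congr rfl fun i _ => dif_pos i.2
    rw [h1, h2]
    ring
  rw [Fintype.sum_sigma]
  refine (Finset.sum_congr rfl fun J _ => hterm J).trans ?_
  rw [← Finset.sum_subtype (p := fun J : Finset (Fin d) => J.card ≤ q)
    (Finset.univ.filter fun J => J.card ≤ q) (by simp) g, prod_transversal I Y a]
  simp only [hac, add_comm (b _ _)]
  -- Every `J ⊆ I` has at most `q` elements, so the size restriction loses no term.
  rw [Finset.prod_add]
  refine Eq.symm (Finset.sum_subset_zero_on_sdiff (fun J hJ => ?_) (fun J hJ => ?_) fun J hJ => ?_)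
  · simpa using (Finset.card_le_card (Finset.mem_powerset.1 hJ)).trans hI.le
  · exact if_neg fun h => (Finset.mem_sdiff.1 hJ).2 (Finset.mem_powerset.2 h)
  · exact (if_pos (Finset.mem_powerset.1 hJ)).symm

theorem card_le_of_isWeaklySaturated (hq : 2 ≤ q) (hqd : q ≤ d) {r : ℕ} (hr : 0 < r)
    (hn : ∀ i, r ≤ n i) {G : Finset (Finset (Σ i, Fin (n i)))}
    (hG : IsWeaklySaturated (completeMultipartite q n)
      (completeMultipartite q fun _ : Fin d => r) G) :
    (completeMultipartite q n).card ≤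
      G.card + Fintype.card (PartialTransversal q fun i => n i - r) := by
  choose b v hbv using fun i => exists_affine_family_support (n i) r (hn i)
  obtain ⟨w, hw⟩ := exists_span_prod (q := q) (fun i => hr.trans_le (hn i)) _ b v
  refine hG.card_le w fun f hf => ?_
  obtain ⟨R, hRcard, hRf, hRe⟩ := copy_range hq hqd hr f hf
  choose a ha c hac using fun i => hbv i (R i) (hRcard i)
  refine ⟨_, hw a c hac, fun h hh => ?_, fun e he hne => ?_⟩
  · rw [if_pos (hf h hh), Finset.prod_map, Finset.prod_ne_zero_iff]
    exact fun x _ => (ha _ _).2 (hRf x)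
  · rw [if_pos he, Finset.prod_ne_zero_iff] at hne
    exact hRe e he fun x hx => (ha _ _).1 (hne x hx)

/-! ### The construction for the upper bound -/

theorem exists_isWeaklySaturated (hqd : q ≤ d) {r : ℕ} (hr : 0 < r) (hn : ∀ i, r ≤ n i) :
    ∃ G, IsWeaklySaturated (completeMultipartite q n)
        (completeMultipartite q fun _ : Fin d => r) G ∧
      G.card + Fintype.card (PartialTransversal q fun i => n i - r) =
        (completeMultipartite q n).card := by
  classical
  have hsup : ∀ J : {J : Finset (Fin d) // J.card ≤ q}, ∃ I : Finset (Fin d),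
      J.1 ⊆ I ∧ I.card = q := fun J => by
    obtain ⟨I, hJI, -, hI⟩ := Finset.exists_subsuperset_card_eq
      (Finset.subset_univ J.1) J.2 (by simpa using hqd)
    exact ⟨I, hJI, hI⟩
  choose I hJI hI using hsup
  -- Coordinates at least `r` encode `p` on `J`; the default `r - 1` marks the classes outside `J`.
  let y : PartialTransversal q (fun i => n i - r) → ∀ i, Fin (n i) := fun p i =>
    if h : i ∈ p.1.1 then ⟨p.2 ⟨i, h⟩ + r, by
      have : (p.2 ⟨i, h⟩ : ℕ) < n i - r := (p.2 ⟨i, h⟩).2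
      omega⟩
    else ⟨r - 1, by have := hn i; omega⟩
  have hy_mem : ∀ p i (h : i ∈ p.1.1), (y p i : ℕ) = p.2 ⟨i, h⟩ + r := fun p i h => by
    simp [y, h]
  have hy_not : ∀ p i, i ∉ p.1.1 → (y p i : ℕ) = r - 1 := fun p i h => by simp [y, h]
  have hy_ge : ∀ p i, r - 1 ≤ (y p i : ℕ) := fun p i => by
    by_cases h : i ∈ p.1.1
    · rw [hy_mem p i h]; omega
    · rw [hy_not p i h]
  let e : PartialTransversal q (fun i => n i - r) → Finset (Σ i, Fin (n i)) := fun p =>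
    transversal (I p.1) fun i => y p i
  have hcoord : ∀ p p', (∀ i ∈ p'.1.1, y p i = y p' i) → p' = p ∨ p'.1.1.card < p.1.1.card := by
    intro p p' h
    have hsub : p'.1.1 ⊆ p.1.1 := fun i hi => by
      by_contra hni
      have h1 := congrArg Fin.val (h i hi)
      rw [hy_not p i hni, hy_mem p' i hi] at h1
      omega
    by_cases hcard : p'.1.1.card < p.1.1.card
    · exact Or.inr hcard
    · left
      have hJ : p'.1 = p.1 := Subtype.ext (Finset.eq_of_subset_of_card_le hsub (not_lt.1 hcard))
      obtain ⟨J, x⟩ := p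
      obtain ⟨J', x'⟩ := p'
      obtain rfl : J' = J := hJ
      congr 1
      funext i
      have h1 := congrArg Fin.val (h i i.2)
      rw [hy_mem _ i i.2, hy_mem _ i i.2] at h1
      exact Fin.ext (Nat.add_right_cancel h1).symm
  have hmem_e : ∀ p i, i ∈ p.1.1 → (⟨i, y p i⟩ : Σ i, Fin (n i)) ∈ e p := fun p i hi =>
    mk_mem_transversal.2 ⟨hJI _ hi, rfl⟩
  have he : Function.Injective e := fun p p' hpp => by
    have key : ∀ p p', e p = e p' → p' = p ∨ p'.1.1.card < p.1.1.card := fun p p' hpp =>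
      hcoord p p' fun i hi => by
        have h1 := hmem_e p' i hi
        rw [← hpp] at h1
        exact (mk_mem_transversal.1 h1).2
    rcases key p p' hpp with h | h
    · exact h.symm
    · rcases key p' p hpp.symm with h' | h'
      · exact h'
      · omega
  have heF : ∀ p, e p ∈ completeMultipartite q n := fun p => transversal_mem (hI p.1) _
  refine ⟨_, isWeaklySaturated_sdiff_image e he heF (fun p => p.1.1.card) fun p => ?_, ?_⟩
  -- The copy on the first `r` vertices of each class, with `r - 1` replaced by `y p`.
  · let f : (Σ _ : Fin d, Fin r) ↪ Σ i, Fin (n i) :=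
      ⟨fun w => ⟨w.1, if (w.2 : ℕ) = r - 1 then y p w.1 else w.2.castLE (hn w.1)⟩, by
        rintro ⟨i, k⟩ ⟨j, l⟩ h
        obtain rfl : i = j := congrArg Sigma.fst h
        have h1 := congrArg Fin.val (eq_of_heq (Sigma.mk.inj h).2)
        have h2 := hy_ge p i
        have h3 := k.2
        have h4 := l.2
        congr 1
        apply Fin.ext
        dsimp only at h1
        split_ifs at h1 <;> simp only [Fin.val_castLE] at h1 <;> omega⟩
    refine ⟨f, fun h hh => ?_, ⟨transversal (I p.1) fun _ => ⟨r - 1, by omega⟩,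
      transversal_mem (hI p.1) _, ?_⟩, fun h _ p' hp' => hcoord p p' fun i hi => ?_⟩
    · rw [mem_completeMultipartite] at hh ⊢
      refine ⟨by rw [Finset.card_map, hh.1], fun v hv v' hv' hvv => ?_⟩
      obtain ⟨w, hw, rfl⟩ := Finset.mem_map.1 (Finset.mem_coe.1 hv)
      obtain ⟨w', hw', rfl⟩ := Finset.mem_map.1 (Finset.mem_coe.1 hv')
      exact congrArg f (hh.2 hw hw' hvv)
    · rw [transversal, Finset.map_map]
      change _ = transversal _ _
      rw [transversal]
      congr 1
      ext i : 1
      exact Sigma.ext rfl (heq_of_eq (if_pos rfl))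
    · have h1 := hmem_e p' i hi
      rw [← hp', Finset.mem_map] at h1
      obtain ⟨⟨j, k⟩, -, hw⟩ := h1
      obtain rfl : j = i := congrArg Sigma.fst hw
      have h2 := eq_of_heq (Sigma.mk.inj hw).2
      dsimp only at h2
      -- The only vertex of the copy in class `j` that can be at least `r` is `y p j`.
      split_ifs at h2 with hk
      · exact h2
      · have h3 := congrArg Fin.val h2
        rw [hy_mem p' j hi, Fin.val_castLE] at h3
        have := k.2
        omega
  · have h1 : Finset.univ.image e ⊆ completeMultipartite q n := fun x hx => by
      obtain ⟨p, -, rfl⟩ := Finset.mem_image.1 hx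
      exact heF p
    have h2 := Finset.card_sdiff_add_card_eq_card h1
    rwa [Finset.card_image_of_injective _ he, Finset.card_univ] at h2

end Multipartite

end WeakSat

theorem corollary2 (d q r : ℕ) (n : Fin d → ℕ) (hq : 2 ≤ q) (hqd : q ≤ d) (hr : 1 ≤ r)
    (hn : ∀ i, r ≤ n i) :
    (WeakSat.wsat (WeakSat.completeMultipartite q n)
        (WeakSat.completeMultipartite q (fun _ : Fin d => r)) : ℤ) =
      (∑ I ∈ (Finset.univ : Finset (Fin d)).powersetCard q, ∏ i ∈ I, (n i : ℤ)) -
        ∑ I : Finset (Fin d) with I.card ≤ q, ∏ i ∈ I, ((n i : ℤ) - (r : ℤ)) := by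
  obtain ⟨⟨G, hG, hGcard⟩, hmin⟩ := WeakSat.wsat_spec (WeakSat.completeMultipartite q n)
    (WeakSat.completeMultipartite q (fun _ : Fin d => r))
  have hlower := WeakSat.card_le_of_isWeaklySaturated hq hqd hr hn hG
  obtain ⟨G', hG', hcard⟩ := WeakSat.exists_isWeaklySaturated (q := q) hqd hr hn
  have hupper := hmin ⟨G', hG', rfl⟩
  have hF : (∑ I ∈ (Finset.univ : Finset (Fin d)).powersetCard q, ∏ i ∈ I, (n i : ℤ)) =
      ((WeakSat.completeMultipartite q n).card : ℤ) := by
    rw [WeakSat.card_completeMultipartite]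
    push_cast
    rfl
  have hP : (∑ I : Finset (Fin d) with I.card ≤ q, ∏ i ∈ I, ((n i : ℤ) - (r : ℤ))) =
      (Fintype.card (WeakSat.PartialTransversal q fun i => n i - r) : ℤ) := by
    rw [WeakSat.card_partialTransversal]
    push_cast [Nat.cast_sub (hn _)]
    rfl
  rw [hF, hP]
  omega
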